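/- Let $A$ be a locally $AW^*$-algebra, that is, a complex topological $^*$-algebra (not assumed unital) which is - a locally $C^*$-algebra: $A$ is topologically $^*$-isomorphic to the projective limit $\varprojlim A_\alpha$ (with the topology induced from the product $\prod_\alpha A_\alpha$) of a projective family of $C^*$-algebras $A_\alpha$ with connecting $^*$-homomorphisms $g_\alpha^\beta : A_\beta \to A_\alpha$, $\alpha \preceq \beta$, over a directed partially ordered set; and - a Baer $^*$-algebra: for every nonempty $S \subseteq A$ there is a projection $e = e^* = e^2 \in A$ such that the right annihilator $R(S) = \{x \in A : sx = 0 \text{ for all } s \in S\}$ equals $eA$. Let $N(A)$ be the set of continuous $C^*$-seminorms on $A$ (continuous submultiplicative seminorms $p$ with $p(a^*a) = p(a)^2$), put $\|a\|_\infty = \sup_{p \in N(A)} p(a)$, and let $b(A) = \{a \in A : \|a\|_\infty < \infty\}$ be the bounded part of $A$, a $^*$-subalgebra of $A$. Then $b(A)$ is an $AW^*$-algebra in the norm $\|\cdot\|_\infty$, i.e. it is a $C^*$-algebra in this norm and a Baer $^*$-algebra, and $b(A)$ is dense in $A$ in the topology of $A$. -/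

import Mathlib

universe u v w

section Baer

variable {A : Type u} [NonUnitalRing A]

/-- The right annihilator `R(S) = {x : s x = 0 for all s ∈ S}`. -/
def rightAnnihilator (S : Set A) : Set A := {x | ∀ s ∈ S, s * x = 0}

variable (A) in
/-- A Baer *-algebra: the right annihilator of every nonempty subset is `eA` for some
projection (self-adjoint idempotent) `e`. -/
def IsBaerStarAlgebra [StarRing A] : Prop :=
  ∀ S : Set A, S.Nonempty →
    ∃ e : A, IsStarProjection e ∧ rightAnnihilator S = {x | ∃ y : A, x = e * y}

end Baer

section ProjectiveLimit

/-- A projective family of C*-algebras over a partially ordered set, with connecting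
*-homomorphisms (automatically continuous) `B β → B α` for `α ≤ β`. -/
structure ProjectiveFamily (Λ : Type v) [PartialOrder Λ] (B : Λ → Type w)
    [∀ α, NonUnitalCStarAlgebra (B α)] where
  map : ∀ {α β : Λ}, α ≤ β → (B β →⋆ₙₐ[ℂ] B α)
  map_self : ∀ (α : Λ) (x : B α), map (le_refl α) x = x
  map_map : ∀ {α β γ : Λ} (h₁ : α ≤ β) (h₂ : β ≤ γ) (x : B γ),
    map h₁ (map h₂ x) = map (h₁.trans h₂) x

/-- The projective limit: the *-subalgebra of compatible families in the product `∏ B α`. As a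
subtype of the product it carries the topology induced by the product topology. -/
def ProjectiveFamily.limit {Λ : Type v} [PartialOrder Λ] {B : Λ → Type w}
    [∀ α, NonUnitalCStarAlgebra (B α)] (P : ProjectiveFamily Λ B) :
    NonUnitalStarSubalgebra ℂ (∀ α, B α) where
  carrier := {x | ∀ (α β : Λ) (h : α ≤ β), P.map h (x β) = x α}
  add_mem' := by
    intro x y hx hy α β h
    simp [hx α β h, hy α β h]
  zero_mem' := by
    intro α β h
    simp
  mul_mem' := by
    intro x y hx hy α β h
    simp [hx α β h, hy α β h]
  smul_mem' := by
    intro c x hx α β h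
    simp [hx α β h]
  star_mem' := by
    intro x hx α β h
    simp [map_star, hx α β h]

/-- A locally C*-algebra: a *-algebra with a topology that is topologically *-isomorphic to the
projective limit of a projective family of C*-algebras over a directed set. (The joint continuity
of the operations and the Hausdorff property follow from the isomorphism.) -/
def IsLocallyCStarAlgebra (A : Type u) [NonUnitalRing A] [Module ℂ A] [StarRing A]
    [TopologicalSpace A] : Prop :=
  ∃ (Λ : Type v) (_ : PartialOrder Λ) (_ : IsDirectedOrder Λ) (_ : Nonempty Λ)
    (B : Λ → Type w) (_ : ∀ α, NonUnitalCStarAlgebra (B α)) (P : ProjectiveFamily Λ B)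
    (φ : A ≃⋆ₐ[ℂ] P.limit), Continuous φ ∧ Continuous φ.symm

/-- A locally AW*-algebra: a locally C*-algebra which is a Baer *-algebra. -/
def IsLocallyAWStarAlgebra (A : Type u) [NonUnitalRing A] [Module ℂ A] [StarRing A]
    [TopologicalSpace A] : Prop :=
  IsLocallyCStarAlgebra.{u, v, w} A ∧ IsBaerStarAlgebra A

end ProjectiveLimit

section Bounded

variable (A : Type u) [NonUnitalRing A] [Module ℂ A] [StarRing A] [TopologicalSpace A]

/-- The set `N(A)` of continuous C*-seminorms on `A`. -/
def continuousCStarSeminorms : Set (Seminorm ℂ A) :=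
  {p | Continuous p ∧ (∀ a b, p (a * b) ≤ p a * p b) ∧ ∀ a, p (star a * a) = p a ^ 2}

variable {A} in
theorem continuousCStarSeminorms_star_le {p : Seminorm ℂ A}
    (hp : p ∈ continuousCStarSeminorms A) (a : A) : p (star a) ≤ p a := by
  have h1 := hp.2.2 (star a)
  have h2 := hp.2.1 (star (star a)) (star a)
  rw [h1, star_star] at h2
  rcases (apply_nonneg p (star a)).eq_or_lt with h | h
  · rw [← h]; exact apply_nonneg p a
  · nlinarith

/-- The bounded part `b(A)`: the elements on which the continuous C*-seminorms are uniformly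
bounded. It is a *-subalgebra of `A`. -/
def boundedPart [IsScalarTower ℂ A A] [SMulCommClass ℂ A A] [StarModule ℂ A] :
    NonUnitalStarSubalgebra ℂ A where
  carrier := {a | ∃ C : ℝ, ∀ p ∈ continuousCStarSeminorms A, p a ≤ C}
  add_mem' := by
    rintro a b ⟨C, hC⟩ ⟨D, hD⟩
    exact ⟨C + D, fun p hp => (map_add_le_add p a b).trans (add_le_add (hC p hp) (hD p hp))⟩
  zero_mem' := ⟨0, fun p _ => by simp⟩
  mul_mem' := by
    rintro a b ⟨C, hC⟩ ⟨D, hD⟩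
    exact ⟨C * D, fun p hp => (hp.2.1 a b).trans
      (mul_le_mul (hC p hp) (hD p hp) (apply_nonneg p b)
        ((apply_nonneg p a).trans (hC p hp)))⟩
  smul_mem' := by
    rintro c a ⟨C, hC⟩
    refine ⟨‖c‖ * C, fun p hp => ?_⟩
    rw [map_smul_eq_mul]
    exact mul_le_mul_of_nonneg_left (hC p hp) (norm_nonneg c)
  star_mem' := by
    rintro a ⟨C, hC⟩
    exact ⟨C, fun p hp => (continuousCStarSeminorms_star_le hp a).trans (hC p hp)⟩

variable {A} in
/-- `‖a‖_∞`, the supremum of `‖a‖_p` over all continuous C*-seminorms `p` of `A`, which for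
`a ∈ b(A)` is the supremum of a nonempty bounded set of reals. -/
noncomputable def supNorm (a : A) : ℝ :=
  ⨆ p : continuousCStarSeminorms A, (p : Seminorm ℂ A) a

end Bounded

section AWStar

variable (B : Type u) [NonUnitalRing B] [Module ℂ B] [StarRing B]

/-- The *-algebra `B` is a C*-algebra in the norm `N`: it is identified, as a *-algebra
with a norm, with a C*-algebra. -/
def IsCStarAlgebraInNorm (N : B → ℝ) : Prop :=
  ∃ (C : Type u) (_ : NonUnitalCStarAlgebra C) (φ : B ≃⋆ₐ[ℂ] C), ∀ b, ‖φ b‖ = N b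

/-- The *-algebra `B` is an AW*-algebra in the norm `N`: it is a C*-algebra in this norm and
a Baer *-algebra. -/
def IsAWStarAlgebraInNorm (N : B → ℝ) : Prop :=
  IsCStarAlgebraInNorm B N ∧ IsBaerStarAlgebra B

end AWStar

/-!
The coordinate norms of a projective limit form a directed family of continuous C*-seminorms
generating the topology. A continuous C*-seminorm `p` is therefore bounded by `C * q` for some
coordinate norm `q`, and the constant disappears upon iterating `p (a* a) = p a ^ 2`, so the
coordinate norms are cofinal in `N(A)`. Hence `b(A)` consists of the compatible families that are
bounded, which is a closed *-subalgebra of the `ℓ^∞`-product of the C*-algebras `B α`, with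
`‖·‖_∞` as the norm. Projections are bounded, so `b(A)` inherits the Baer property. Finally, a
self-adjoint element is the limit of its truncations to `[-n, n]`, formed coordinatewise by
functional calculus: each coordinate of the sequence is eventually constant.
-/

open Filter Topology Set
open scoped ENNReal CStarAlgebra

section CStarIdentity

theorem le_of_forall_pow_two_pow_le_mul {x y C : ℝ} (hy : 0 ≤ y)
    (h : ∀ n : ℕ, x ^ 2 ^ n ≤ C * y ^ 2 ^ n) : x ≤ y := by
  by_contra! hyx
  have hx : 0 < x := hy.trans_lt hyx
  have hlim : Tendsto (fun n : ℕ => C * (y / x) ^ 2 ^ n) atTop (𝓝 (C * 0)) :=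
    ((tendsto_pow_atTop_nhds_zero_of_lt_one (by positivity) ((div_lt_one hx).2 hyx)).comp
      (tendsto_pow_atTop_atTop_of_one_lt one_lt_two)).const_mul C
  obtain ⟨n, hn⟩ := (hlim.eventually_lt_const (by simp : C * 0 < 1)).exists
  rw [div_pow, ← mul_div_assoc, div_lt_one (by positivity)] at hn
  exact (h n).not_gt hn

variable {A : Type*} [Mul A] [Star A] {p q : A → ℝ}

theorem apply_iterate_star_mul_self (hp : ∀ a, p (star a * a) = p a ^ 2) (n : ℕ) (a : A) :
    p ((fun x => star x * x)^[n] a) = p a ^ 2 ^ n := by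
  induction n with
  | zero => simp
  | succ n ih => rw [Function.iterate_succ_apply', hp, ih, ← pow_mul, pow_succ]

theorem le_of_le_mul_of_star_mul_self (hp : ∀ a, p (star a * a) = p a ^ 2)
    (hq : ∀ a, q (star a * a) = q a ^ 2) (hq₀ : ∀ a, 0 ≤ q a) {C : ℝ} (h : ∀ a, p a ≤ C * q a)
    (a : A) : p a ≤ q a :=
  le_of_forall_pow_two_pow_le_mul (hq₀ a) fun n => by
    simpa only [apply_iterate_star_mul_self hp, apply_iterate_star_mul_self hq] using
      h ((fun x => star x * x)^[n] a)

end CStarIdentity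

section DirectedSeminorms

variable {𝕜 A ι : Type*} [NontriviallyNormedField 𝕜] [NonUnitalNonAssocRing A] [Module 𝕜 A]
  [Star A] [TopologicalSpace A] [Nonempty ι] {q : SeminormFamily 𝕜 A ι}

theorem exists_le_of_withSeminorms_of_directed (hq : WithSeminorms q)
    (hdir : Directed (· ≤ ·) q) (hqs : ∀ i a, q i (star a * a) = q i a ^ 2)
    {p : Seminorm 𝕜 A} (hp : Continuous p) (hps : ∀ a, p (star a * a) = p a ^ 2) :
    ∃ i, p ≤ q i := by
  obtain ⟨s, C, -, hC⟩ := Seminorm.bound_of_continuous hq p hp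
  obtain ⟨i, hi⟩ := hdir.finset_le s
  refine ⟨i, le_of_le_mul_of_star_mul_self hps (hqs i) (apply_nonneg (q i)) (C := C) fun a => ?_⟩
  calc p a ≤ C * s.sup q a := hC a
    _ ≤ C * q i a := by gcongr; exact Finset.sup_le hi a

end DirectedSeminorms

section BoundedPart

variable {A : Type*} [NonUnitalRing A] [Module ℂ A] [StarRing A] [TopologicalSpace A]

section Cofinal

variable {ι : Type*} {q : ι → Seminorm ℂ A}

theorem mem_boundedPart_iff_of_cofinal [IsScalarTower ℂ A A] [SMulCommClass ℂ A A]
    [StarModule ℂ A] (hq : ∀ i, q i ∈ continuousCStarSeminorms A)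
    (hcof : ∀ p ∈ continuousCStarSeminorms A, ∃ i, p ≤ q i) {a : A} :
    a ∈ boundedPart A ↔ ∃ C : ℝ, ∀ i, q i a ≤ C := by
  refine exists_congr fun C => ⟨fun h i => h _ (hq i), fun h p hp => ?_⟩
  obtain ⟨i, hi⟩ := hcof p hp
  exact (hi a).trans (h i)

theorem supNorm_eq_iSup_of_cofinal (hq : ∀ i, q i ∈ continuousCStarSeminorms A)
    (hcof : ∀ p ∈ continuousCStarSeminorms A, ∃ i, p ≤ q i) (a : A) :
    supNorm a = ⨆ i, q i a := by
  refine csSup_eq_csSup_of_forall_exists_le ?_ ?_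
  · rintro _ ⟨⟨p, hp⟩, rfl⟩
    obtain ⟨i, hi⟩ := hcof p hp
    exact ⟨q i a, mem_range_self i, hi a⟩
  · rintro _ ⟨i, rfl⟩
    exact ⟨q i a, ⟨⟨q i, hq i⟩, rfl⟩, le_rfl⟩

end Cofinal

variable [IsScalarTower ℂ A A] [SMulCommClass ℂ A A] [StarModule ℂ A]

theorem mem_boundedPart_of_isStarProjection {e : A} (he : IsStarProjection e) :
    e ∈ boundedPart A := by
  refine ⟨1, fun p hp => ?_⟩
  have h : p e = p e ^ 2 := by
    simpa only [he.isSelfAdjoint.star_eq, he.isIdempotentElem.eq] using hp.2.2 e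
  nlinarith

end BoundedPart

theorem IsBaerStarAlgebra.of_isStarProjection_mem {A σ : Type*} [NonUnitalRing A] [StarRing A]
    [SetLike σ A] [NonUnitalSubringClass σ A] [StarMemClass σ A] (hA : IsBaerStarAlgebra A)
    {B : σ} (hB : ∀ e : A, IsStarProjection e → e ∈ B) : IsBaerStarAlgebra B := by
  intro S hS
  obtain ⟨e, he, hann⟩ := hA (Subtype.val '' S) (hS.image _)
  refine ⟨⟨e, hB e he⟩, ⟨Subtype.ext he.isIdempotentElem, Subtype.ext he.isSelfAdjoint⟩,
    Set.ext fun x => ?_⟩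
  have hx : x ∈ rightAnnihilator S ↔ ∃ y, (x : A) = e * y := by
    simpa [rightAnnihilator, Subtype.ext_iff] using Set.ext_iff.1 hann x
  rw [hx]
  constructor
  · rintro ⟨y, hy⟩
    refine ⟨x, Subtype.ext ?_⟩
    calc (x : A) = e * e * y := by rw [he.isIdempotentElem.eq, hy]
      _ = e * x := by rw [mul_assoc, hy]
  · rintro ⟨y, rfl⟩
    exact ⟨y, rfl⟩

theorem isCStarAlgebraInNorm_of_isClosed_range {C : Type u} [NonUnitalRing C] [Module ℂ C]
    [IsScalarTower ℂ C C] [SMulCommClass ℂ C C] [StarRing C] [StarModule ℂ C]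
    {D : Type*} [NonUnitalCStarAlgebra D] (ψ : C →⋆ₙₐ[ℂ] D) (hinj : Function.Injective ψ)
    (hclosed : IsClosed (range ψ)) : IsCStarAlgebraInNorm C fun c => ‖ψ c‖ := by
  let _ : NonUnitalNormedRing C := NonUnitalNormedRing.induced C D ψ hinj
  let _ : NormedSpace ℂ C := NormedSpace.induced ℂ C D (ψ : C →ₗ[ℂ] D)
  have hiso : Isometry ψ := AddMonoidHomClass.isometry_of_norm ψ fun _ => rfl
  have : CompleteSpace C :=
    (completeSpace_iff_isComplete_range hiso.isUniformInducing).2 hclosed.isComplete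
  have : CStarRing C := ⟨fun x => by
    change ‖ψ x‖ * ‖ψ x‖ ≤ ‖ψ (star x * x)‖
    rw [map_mul, map_star, CStarRing.norm_star_mul_self]⟩
  exact ⟨C, {}, StarAlgEquiv.refl ℂ C, fun _ => rfl⟩

theorem dense_of_isSelfAdjoint_mem_closure {E : Type*} [AddCommGroup E] [Module ℂ E]
    [StarAddMonoid E] [StarModule ℂ E] [TopologicalSpace E] [ContinuousAdd E]
    [ContinuousConstSMul ℂ E] {S : Submodule ℂ E}
    (h : ∀ a : E, IsSelfAdjoint a → a ∈ closure (S : Set E)) : Dense (S : Set E) := by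
  intro a
  have key (b : selfAdjoint E) : (b : E) ∈ S.topologicalClosure := h b b.2
  rw [← realPart_add_I_smul_imaginaryPart a]
  exact S.topologicalClosure.add_mem (key _) (S.topologicalClosure.smul_mem _ (key _))

section Clamp

/-- The truncation of the real number `t` to the interval `[-r, r]`, meant for `0 ≤ r`. Functional
calculus with it cuts self-adjoint elements down to norm at most `r`. -/
def clamp (r t : ℝ) : ℝ := max (-r) (min r t)

theorem continuous_clamp (r : ℝ) : Continuous (clamp r) := by
  unfold clamp
  fun_prop

theorem abs_clamp_le {r : ℝ} (hr : 0 ≤ r) (t : ℝ) : |clamp r t| ≤ r :=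
  abs_le.2 ⟨le_max_left _ _, max_le (by linarith) (min_le_left _ _)⟩

theorem clamp_eq_self {r t : ℝ} (ht : |t| ≤ r) : clamp r t = t := by
  rw [clamp, min_eq_right (abs_le.1 ht).2, max_eq_right (abs_le.1 ht).1]

variable {D : Type*} [NonUnitalCStarAlgebra D] {r : ℝ}

theorem norm_cfcₙ_clamp_le (hr : 0 ≤ r) (b : D) : ‖cfcₙ (clamp r) b‖ ≤ r :=
  norm_cfcₙ_le fun t _ => abs_clamp_le hr t

theorem cfcₙ_clamp_eq_self {b : D} (hb : IsSelfAdjoint b) (h : ‖b‖ ≤ r) :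
    cfcₙ (clamp r) b = b := by
  conv_rhs => rw [← cfcₙ_id' ℝ b hb]
  refine cfcₙ_congr fun t ht => clamp_eq_self ?_
  calc |t| ≤ ‖cfcₙ (fun x : ℝ => x) b‖ := norm_apply_le_norm_cfcₙ (fun x : ℝ => x) b ht
    _ = ‖b‖ := by rw [cfcₙ_id' ℝ b hb]
    _ ≤ r := h

end Clamp

section HomSeminorm

variable {A D : Type*} [NonUnitalRing A] [Module ℂ A] [StarRing A] [NonUnitalCStarAlgebra D]

/-- The C*-seminorm `a ↦ ‖ψ a‖` of a *-homomorphism `ψ` into a C*-algebra. -/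
noncomputable def homSeminorm (ψ : A →⋆ₙₐ[ℂ] D) : Seminorm ℂ A :=
  (normSeminorm ℂ D).comp (ψ : A →ₗ[ℂ] D)

theorem homSeminorm_apply (ψ : A →⋆ₙₐ[ℂ] D) (a : A) : homSeminorm ψ a = ‖ψ a‖ := rfl

theorem homSeminorm_mem_continuousCStarSeminorms [TopologicalSpace A] {ψ : A →⋆ₙₐ[ℂ] D}
    (hψ : Continuous ψ) : homSeminorm ψ ∈ continuousCStarSeminorms A := by
  refine ⟨hψ.norm, fun a b => ?_, fun a => ?_⟩
  · simpa only [homSeminorm_apply, map_mul] using norm_mul_le (ψ a) (ψ b)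
  · simp only [homSeminorm_apply, map_mul, map_star, CStarRing.norm_star_mul_self, sq]

end HomSeminorm

section BoundedPartToLp

variable {A Λ : Type*} [NonUnitalRing A] [Module ℂ A] [StarRing A] [TopologicalSpace A]
  [IsScalarTower ℂ A A] [SMulCommClass ℂ A A] [StarModule ℂ A] {B : Λ → Type*}
  [∀ α, NonUnitalCStarAlgebra (B α)] {π : ∀ α, A →⋆ₙₐ[ℂ] B α}

/-- The *-homomorphism `a ↦ (π α a)_α` from the bounded part to the C*-algebra of bounded families,
for continuous *-homomorphisms `π α` into C*-algebras. -/
noncomputable def boundedPartToLp (hπ : ∀ α, Continuous (π α)) : boundedPart A →⋆ₙₐ[ℂ] lp B ∞ where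
  toFun a := ⟨fun α => π α a, memℓp_infty <| by
    obtain ⟨C, hC⟩ := a.2
    exact ⟨C, forall_mem_range.2 fun α => hC _ (homSeminorm_mem_continuousCStarSeminorms (hπ α))⟩⟩
  map_smul' c a := by ext α; exact map_smul (π α) c (a : A)
  map_zero' := by ext α; exact map_zero (π α)
  map_add' a b := by ext α; exact map_add (π α) (a : A) b
  map_mul' a b := by ext α; exact map_mul (π α) (a : A) b
  map_star' a := by ext α; exact map_star (π α) (a : A)

end BoundedPartToLp

namespace ProjectiveFamily

variable {Λ : Type v} [PartialOrder Λ] {B : Λ → Type w} [∀ α, NonUnitalCStarAlgebra (B α)]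
  {P : ProjectiveFamily Λ B}

theorem isClosed_limit : IsClosed (P.limit : Set (∀ α, B α)) := by
  have hlimit : (P.limit : Set (∀ α, B α)) =
      ⋂ (α : Λ) (β : Λ) (h : α ≤ β), {x | P.map h (x β) = x α} := by
    ext x
    simp only [mem_iInter]
    exact Iff.rfl
  rw [hlimit]
  exact isClosed_iInter fun α => isClosed_iInter fun β => isClosed_iInter fun h =>
    isClosed_eq ((map_continuous (P.map h)).comp (continuous_apply β)) (continuous_apply α)

/-- The *-homomorphisms `π α : A → B α` exhibit the topological *-algebra `A` as the projective
limit of `P`. This replaces a topological *-isomorphism `A ≃ P.limit` by its coordinates. -/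
structure IsLimitCone (P : ProjectiveFamily Λ B) {A : Type*} [NonUnitalRing A] [Module ℂ A]
    [StarRing A] [TopologicalSpace A] (π : ∀ α, A →⋆ₙₐ[ℂ] B α) : Prop where
  isEmbedding : IsEmbedding fun a α => π α a
  range_eq : range (fun a α => π α a) = P.limit

namespace IsLimitCone

variable {A : Type u} [NonUnitalRing A] [Module ℂ A] [StarRing A] [TopologicalSpace A]
  {π : ∀ α, A →⋆ₙₐ[ℂ] B α}

theorem continuous_proj (hπ : P.IsLimitCone π) (α : Λ) : Continuous (π α) :=
  (continuous_apply α).comp hπ.isEmbedding.continuous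

theorem map_proj (hπ : P.IsLimitCone π) {α β : Λ} (h : α ≤ β) (a : A) :
    P.map h (π β a) = π α a := by
  have ha : (fun α => π α a) ∈ P.limit := hπ.range_eq.le (mem_range_self a)
  exact ha α β h

theorem exists_proj_eq (hπ : P.IsLimitCone π) {x : ∀ α, B α} (hx : x ∈ P.limit) :
    ∃ a, ∀ α, π α a = x α := by
  obtain ⟨a, rfl⟩ := hπ.range_eq.ge hx
  exact ⟨a, fun _ => rfl⟩

theorem exists_proj_eq_cfcₙ (hπ : P.IsLimitCone π) {f : ℝ → ℝ} (hf : Continuous f)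
    (hf₀ : f 0 = 0) {a : A} (ha : IsSelfAdjoint a) : ∃ b, ∀ α, π α b = cfcₙ f (π α a) := by
  refine hπ.exists_proj_eq fun α β h => ?_
  rw [NonUnitalStarAlgHom.map_cfcₙ (P.map h) f _ hf.continuousOn hf₀ (map_continuous _)
    (ha.map (π β)) ((ha.map (π β)).map _), hπ.map_proj]

theorem withSeminorms (hπ : P.IsLimitCone π) :
    WithSeminorms fun α => homSeminorm (π α) := by
  have : IsTopologicalAddGroup A :=
    hπ.isEmbedding.isInducing.topologicalAddGroup (LinearMap.pi fun α => (π α : A →ₗ[ℂ] B α))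
  rw [SeminormFamily.withSeminorms_iff_nhds_eq_iInf, hπ.isEmbedding.isInducing.nhds_eq_comap,
    nhds_pi, Filter.pi, comap_iInf]
  refine iInf_congr fun α => ?_
  rw [comap_comap, map_zero (π α), ← comap_norm_nhds_zero, comap_comap]
  rfl

theorem homSeminorm_mem (hπ : P.IsLimitCone π) (α : Λ) :
    homSeminorm (π α) ∈ continuousCStarSeminorms A :=
  homSeminorm_mem_continuousCStarSeminorms (hπ.continuous_proj α)

theorem directed_homSeminorm [IsDirectedOrder Λ] (hπ : P.IsLimitCone π) :
    Directed (· ≤ ·) fun α => homSeminorm (π α) :=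
  Monotone.directed_le fun α β h a => by
    simpa only [homSeminorm_apply, hπ.map_proj] using
      NonUnitalStarAlgHom.norm_apply_le (P.map h) (π β a)

theorem exists_le_homSeminorm [IsDirectedOrder Λ] [Nonempty Λ] (hπ : P.IsLimitCone π) :
    ∀ p ∈ continuousCStarSeminorms A, ∃ α, p ≤ homSeminorm (π α) := fun _ hp =>
  exists_le_of_withSeminorms_of_directed hπ.withSeminorms hπ.directed_homSeminorm
    (fun α => (hπ.homSeminorm_mem α).2.2) hp.1 hp.2.2

variable [IsScalarTower ℂ A A] [SMulCommClass ℂ A A] [StarModule ℂ A]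

theorem mem_boundedPart_iff [IsDirectedOrder Λ] [Nonempty Λ] (hπ : P.IsLimitCone π) {a : A} :
    a ∈ boundedPart A ↔ ∃ C : ℝ, ∀ α, ‖π α a‖ ≤ C :=
  mem_boundedPart_iff_of_cofinal hπ.homSeminorm_mem hπ.exists_le_homSeminorm

theorem norm_boundedPartToLp [IsDirectedOrder Λ] [Nonempty Λ] (hπ : P.IsLimitCone π)
    (a : boundedPart A) : ‖boundedPartToLp hπ.continuous_proj a‖ = supNorm (a : A) :=
  (lp.norm_eq_ciSup _).trans
    (supNorm_eq_iSup_of_cofinal hπ.homSeminorm_mem hπ.exists_le_homSeminorm _).symm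

theorem boundedPartToLp_injective (hπ : P.IsLimitCone π) :
    Function.Injective (boundedPartToLp hπ.continuous_proj) := fun _ _ h =>
  Subtype.ext (hπ.isEmbedding.injective (congrArg Subtype.val h))

theorem range_boundedPartToLp [IsDirectedOrder Λ] [Nonempty Λ] (hπ : P.IsLimitCone π) :
    range (boundedPartToLp hπ.continuous_proj) =
      (fun f : lp B ∞ => (f : ∀ α, B α)) ⁻¹' P.limit := by
  ext f
  constructor
  · rintro ⟨a, rfl⟩
    exact fun α β h => hπ.map_proj h a
  · intro hf
    obtain ⟨a, ha⟩ := hπ.exists_proj_eq hf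
    have hbdd : a ∈ boundedPart A := hπ.mem_boundedPart_iff.2
      ⟨‖f‖, fun α => (ha α).symm ▸ lp.norm_apply_le_norm ENNReal.top_ne_zero f α⟩
    exact ⟨⟨a, hbdd⟩, lp.ext (funext ha)⟩

theorem isCStarAlgebraInNorm_boundedPart [IsDirectedOrder Λ] [Nonempty Λ]
    (hπ : P.IsLimitCone π) :
    IsCStarAlgebraInNorm (boundedPart A) fun a => supNorm (a : A) := by
  have hclosed : IsClosed (range (boundedPartToLp hπ.continuous_proj)) := by
    rw [hπ.range_boundedPartToLp]
    exact isClosed_limit.preimage (continuous_pi fun α => (lp.evalCLM ℂ B ∞ α).continuous)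
  simpa only [hπ.norm_boundedPartToLp] using
    isCStarAlgebraInNorm_of_isClosed_range _ hπ.boundedPartToLp_injective hclosed

theorem mem_closure_boundedPart_of_isSelfAdjoint [IsDirectedOrder Λ] [Nonempty Λ]
    (hπ : P.IsLimitCone π) {a : A} (ha : IsSelfAdjoint a) :
    a ∈ closure (boundedPart A : Set A) := by
  have hclamp (n : ℕ) := hπ.exists_proj_eq_cfcₙ (continuous_clamp n)
    (clamp_eq_self (by simp)) ha
  choose b hb using hclamp
  have hbdd (n : ℕ) : b n ∈ boundedPart A :=
    hπ.mem_boundedPart_iff.2 ⟨n, fun α => hb n α ▸ norm_cfcₙ_clamp_le n.cast_nonneg _⟩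
  have hconst (α : Λ) : ∀ᶠ n in atTop, π α (b n) = π α a := by
    filter_upwards [tendsto_natCast_atTop_atTop.eventually_ge_atTop ‖π α a‖] with n hn
    rw [hb, cfcₙ_clamp_eq_self (ha.map (π α)) hn]
  have hlim : Tendsto b atTop (𝓝 a) :=
    hπ.isEmbedding.tendsto_nhds_iff.2 <| tendsto_pi_nhds.2 fun α =>
      tendsto_const_nhds.congr' ((hconst α).mono fun _ h => h.symm)
  exact mem_closure_of_tendsto hlim (Eventually.of_forall hbdd)

theorem dense_boundedPart [IsDirectedOrder Λ] [Nonempty Λ] (hπ : P.IsLimitCone π) :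
    Dense (boundedPart A : Set A) := by
  have := hπ.withSeminorms.topologicalAddGroup
  have := hπ.withSeminorms.continuousSMul
  exact dense_of_isSelfAdjoint_mem_closure (S := (boundedPart A).toSubmodule) fun _ =>
    hπ.mem_closure_boundedPart_of_isSelfAdjoint

end IsLimitCone

theorem exists_isLimitCone {A : Type*} [NonUnitalRing A] [Module ℂ A] [StarRing A]
    [TopologicalSpace A] (φ : A ≃⋆ₐ[ℂ] P.limit) (hφ : Continuous φ) (hφ' : Continuous φ.symm) :
    ∃ π : ∀ α, A →⋆ₙₐ[ℂ] B α, P.IsLimitCone π := by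
  refine ⟨fun α => (Pi.evalNonUnitalStarAlgHom ℂ B α).comp
    ((NonUnitalStarSubalgebraClass.subtype P.limit).comp (φ : A →⋆ₙₐ[ℂ] P.limit)), ?_, ?_⟩
  · exact IsEmbedding.subtypeVal.comp (Homeomorph.mk φ.toEquiv hφ hφ').isEmbedding
  · exact (φ.surjective.range_comp Subtype.val).trans Subtype.range_coe

end ProjectiveFamily

namespace IsLocallyCStarAlgebra

variable {A : Type u} [NonUnitalRing A] [Module ℂ A] [IsScalarTower ℂ A A] [SMulCommClass ℂ A A]
  [StarRing A] [StarModule ℂ A] [TopologicalSpace A]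

theorem isCStarAlgebraInNorm_boundedPart (hA : IsLocallyCStarAlgebra.{u, v, w} A) :
    IsCStarAlgebraInNorm (boundedPart A) fun a => supNorm (a : A) := by
  obtain ⟨_, _, _, _, _, _, _, φ, hφ, hφ'⟩ := hA
  obtain ⟨_, hπ⟩ := ProjectiveFamily.exists_isLimitCone φ hφ hφ'
  exact hπ.isCStarAlgebraInNorm_boundedPart

theorem dense_boundedPart (hA : IsLocallyCStarAlgebra.{u, v, w} A) :
    Dense (boundedPart A : Set A) := by
  obtain ⟨_, _, _, _, _, _, _, φ, hφ, hφ'⟩ := hA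
  obtain ⟨_, hπ⟩ := ProjectiveFamily.exists_isLimitCone φ hφ hφ'
  exact hπ.dense_boundedPart

end IsLocallyCStarAlgebra

theorem theorem3 (A : Type u) [NonUnitalRing A] [Module ℂ A] [IsScalarTower ℂ A A]
    [SMulCommClass ℂ A A] [StarRing A] [StarModule ℂ A] [TopologicalSpace A]
    (hA : IsLocallyAWStarAlgebra.{u, v, w} A) :
    IsAWStarAlgebraInNorm (boundedPart A) (fun a => supNorm (a : A)) ∧
      Dense (boundedPart A : Set A) := by
  obtain ⟨hCStar, hBaer⟩ := hA
  exact ⟨⟨hCStar.isCStarAlgebraInNorm_boundedPart,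
    hBaer.of_isStarProjection_mem fun _ => mem_boundedPart_of_isStarProjection⟩,
    hCStar.dense_boundedPart⟩
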